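/- Conventions. For a class $\mathcal K$ of objects of an abelian category $\mathcal A$, let $\mathcal K^{\perp}$ be the class of objects $X$ such that $\mathcal A(-,X)$ sends every monomorphism with cokernel in $\mathcal K$ to a surjection, and let ${}^{\perp}\mathcal K$ be the class of objects $X$ such that $\mathcal A(X,-)$ sends every epimorphism with kernel in $\mathcal K$ to a surjection. A pair $(\mathcal X,\mathcal Y)$ of classes of objects of $\mathcal A$ is a cotorsion theory if $\mathcal X={}^{\perp}\mathcal Y$ and $\mathcal Y=\mathcal X^{\perp}$. For such a pair, $\underline{\mathcal Y}$ is the class of those $Y\in\mathcal Y$ such that for every exact sequence $0\to Y\xrightarrow{u} A\to X$ with $X\in\mathcal X$ the morphism $u$ has a retraction. Let $\mathcal A_1,\mathcal A_2,\mathcal A_3$ be abelian categories and let $$T:\mathcal A_1\times\mathcal A_2\to\mathcal A_3,\quad H:\mathcal A_2^{op}\times\mathcal A_3\to\mathcal A_1,\quad C:\mathcal A_1^{op}\times\mathcal A_3\to\mathcal A_2$$ be biadditive functors together with natural isomorphisms $$\mathcal A_3(T(X_1,X_2),X_3)\cong\mathcal A_1(X_1,H(X_2,X_3))\cong\mathcal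 A_2(X_2,C(X_1,X_3))$$ (a biadditive THC-situation, or adjunction of two variables). Assume that $\mathcal A_1$ and $\mathcal A_2$ have all (small) limits and that $\mathcal A_3$ has all (small) colimits. An object $P_1$ of $\mathcal A_1$ (resp. $P_2$ of $\mathcal A_2$) is called flat if $T(P_1,-)$ (resp. $T(-,P_2)$) preserves monomorphisms; $\mathcal F$ denotes the class of flat objects of $\mathcal A_2$. Let $Ch(\mathcal A_i)$ be the category of $\mathbb Z$-indexed chain complexes in $\mathcal A_i$. For complexes $\mathbf C'$ in $\mathcal A_1$ and $\mathbf C$ in $\mathcal A_2$, let $T(\mathbf C',\mathbf C)$ be the complex in $\mathcal A_3$ with $T(\mathbf C',\mathbf C)_n=\bigoplus_{p+q=n}T(\mathbf C'_p,\mathbf C_q)$ whose differential is given on the summand $T(\mathbf C'_p,\mathbf C_q)$ by $T(d'_p,\mathbf C_q)+(-1)^pT(\mathbf C'_p,d_q)$. For an object $E$ of $\mathcal A_1$, let $S^0(E)$ be the complex with $E$ in degree $0$ and $0$ elsewhere. Let $tex(\mathcal F)$ be the class of complexes $\mathbf C$ in $\mathcal A_2$ such that $\mathbf C$ is exact, $\mathbf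 C_n\in\mathcal F$ for all $n\in\mathbb Z$, and $T(S^0(E),\mathbf C)$ is exact for every injective object $E$ of $\mathcal A_1$ (the $F$-totally acyclic complexes). Theorem. Suppose that (1) for $i=1,2$, every object of $\mathcal A_i$ is a quotient of a flat object; (2) $\mathcal A_3$ has enough injective objects; (3) every object of $\mathcal A_2$ is a subobject of an object of $\underline{\mathcal F^{\perp}}$, where the underline is formed with respect to the pair $(\mathcal F,\mathcal F^{\perp})$. Then $(tex(\mathcal F),tex(\mathcal F)^{\perp})$ is a cotorsion theory in $Ch(\mathcal A_2)$. -/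

import Mathlib

open CategoryTheory CategoryTheory.Limits Opposite

universe v v₁ v₂ v₃ u u₁ u₂ u₃

/-! ### Cotorsion theories in an abelian category -/

namespace Cotorsion

variable {A : Type u} [Category.{v} A] [Abelian A]

/-- The class `K^⊥`: the objects `X` such that `A(-, X)` sends every monomorphism
with cokernel in `K` to a surjection. -/
def rightPerp (K : ObjectProperty A) : ObjectProperty A := fun X =>
  ∀ ⦃S : ShortComplex A⦄, S.ShortExact → K S.X₃ →
    Function.Surjective (fun g : S.X₂ ⟶ X => S.f ≫ g)

/-- The class `^⊥K`: the objects `X` such that `A(X, -)` sends every epimorphism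
with kernel in `K` to a surjection. -/
def leftPerp (K : ObjectProperty A) : ObjectProperty A := fun X =>
  ∀ ⦃S : ShortComplex A⦄, S.ShortExact → K S.X₁ →
    Function.Surjective (fun g : X ⟶ S.X₂ => g ≫ S.g)

/-- A cotorsion theory: a pair of classes with `X = ^⊥Y` and `Y = X^⊥`. -/
structure IsCotorsionTheory (X Y : ObjectProperty A) : Prop where
  left_eq : X = leftPerp Y
  right_eq : Y = rightPerp X

/-- The class `\underline{Y}` of a pair `(X, Y)`: the `Y₀ ∈ Y` such that for every exact
sequence `Y₀ ↣ B ⟶ X₀` with `X₀ ∈ X` (the last map need not be an epimorphism), the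
monomorphism `Y₀ ↣ B` has a retraction. -/
def underlineRight (X Y : ObjectProperty A) : ObjectProperty A := fun Y₀ =>
  Y Y₀ ∧ ∀ ⦃B X₀ : A⦄ (i : Y₀ ⟶ B) (p : B ⟶ X₀) (w : i ≫ p = 0),
    Mono i → (ShortComplex.mk i p w).Exact → X X₀ → IsSplitMono i

/-- Every object is a quotient of an object of `P`. -/
def EnoughQuot (P : ObjectProperty A) : Prop :=
  ∀ B : A, ∃ (X : A) (p : X ⟶ B), P X ∧ Epi p

/-- Every object is a subobject of an object of `P`. -/
def EnoughSub (P : ObjectProperty A) : Prop :=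
  ∀ B : A, ∃ (Y : A) (i : B ⟶ Y), P Y ∧ Mono i

/-- The class `ex(P)` of exact chain complexes (indexed by `ℤ`) that are degreewise in `P`. -/
def ex (P : ObjectProperty A) : ObjectProperty (ChainComplex A ℤ) := fun K =>
  K.Acyclic ∧ ∀ n : ℤ, P (K.X n)

end Cotorsion

/-- The signs for total complexes of `ℤ`-indexed chain complexes: the summand of bidegree
`(p, q)` carries the differential `d' ⊗ 1 + (-1)^p (1 ⊗ d)`. -/
instance tensorSignsDownInt : ComplexShape.TensorSigns (ComplexShape.down ℤ) where
  ε' := MonoidHom.mk' Int.negOnePow Int.negOnePow_add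
  rel_add p q r (hpq : q + 1 = p) := by
    change q + r + 1 = p + r
    omega
  add_rel p q r (hpq : q + 1 = p) := by
    change r + q + 1 = r + p
    omega
  ε'_succ p q (hpq : q + 1 = p) := by
    subst hpq
    change q.negOnePow = -(q + 1).negOnePow
    rw [Int.negOnePow_succ, neg_neg]

/-! ### Tensor-hom-cotensor situations -/

/-- A biadditive tensor-hom-cotensor situation (adjunction of two variables): bifunctors
`T : A₁ × A₂ → A₃`, `H : A₂ᵒᵖ × A₃ → A₁`, `C : A₁ᵒᵖ × A₃ → A₂`, written in curried form, with
isomorphisms `A₃(T(X₁, X₂), X₃) ≅ A₁(X₁, H(X₂, X₃))` and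
`A₃(T(X₁, X₂), X₃) ≅ A₂(X₂, C(X₁, X₃))` natural in the three variables. Biadditivity is
required of `T`; by the adjunctions it then holds for `H` and `C`. -/
structure BiadditiveTHC (A₁ : Type u₁) (A₂ : Type u₂) (A₃ : Type u₃)
    [Category.{v₁} A₁] [Category.{v₂} A₂] [Category.{v₃} A₃]
    [Preadditive A₁] [Preadditive A₂] [Preadditive A₃] where
  T : A₁ ⥤ A₂ ⥤ A₃
  H : A₂ᵒᵖ ⥤ A₃ ⥤ A₁
  C : A₁ᵒᵖ ⥤ A₃ ⥤ A₂
  adjH : T.flip ⊣₂ H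
  adjC : T ⊣₂ C
  additive_left : T.Additive
  additive_right : ∀ X₁ : A₁, (T.obj X₁).Additive

namespace BiadditiveTHC

variable {A₁ : Type u₁} {A₂ : Type u₂} {A₃ : Type u₃}
  [Category.{v₁} A₁] [Category.{v₂} A₂] [Category.{v₃} A₃]

instance [Preadditive A₁] [Preadditive A₂] [Preadditive A₃] (S : BiadditiveTHC A₁ A₂ A₃) :
    S.T.Additive := S.additive_left

instance [Preadditive A₁] [Preadditive A₂] [Preadditive A₃] (S : BiadditiveTHC A₁ A₂ A₃)
    (X₁ : A₁) : (S.T.obj X₁).Additive := S.additive_right X₁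

/-- The flat objects `P₁` of `A₁`: `T(P₁, -)` preserves monomorphisms. -/
def flat₁ [Preadditive A₁] [Preadditive A₂] [Preadditive A₃] (S : BiadditiveTHC A₁ A₂ A₃) :
    ObjectProperty A₁ :=
  fun P₁ => (S.T.obj P₁).PreservesMonomorphisms

/-- The flat objects `P₂` of `A₂`: `T(-, P₂)` preserves monomorphisms. -/
def flat₂ [Preadditive A₁] [Preadditive A₂] [Preadditive A₃] (S : BiadditiveTHC A₁ A₂ A₃) :
    ObjectProperty A₂ :=
  fun P₂ => (S.T.flip.obj P₂).PreservesMonomorphisms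

instance [Abelian A₁] [Abelian A₂] [Abelian A₃] [HasColimits A₃] (S : BiadditiveTHC A₁ A₂ A₃)
    (K₁ : ChainComplex A₁ ℤ) (K₂ : ChainComplex A₂ ℤ) :
    HomologicalComplex.HasMapBifunctor K₁ K₂ S.T (ComplexShape.down ℤ) := by
  have : HasColimitsOfSize.{0, 0} A₃ := hasColimitsOfSizeShrink.{0, 0, v₃, v₃} A₃
  intro n
  infer_instance

/-- The tensor of the standard tensor-hom-cotensor situation on chain complexes:
`T(K₁, K₂)ₙ = ⨁_{p + q = n} T((K₁)ₚ, (K₂)_q)`, with differential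
`T(d, 1) + (-1)^p T(1, d)` on the summand of bidegree `(p, q)`. -/
noncomputable def chainT [Abelian A₁] [Abelian A₂] [Abelian A₃] [HasColimits A₃]
    (S : BiadditiveTHC A₁ A₂ A₃) :
    ChainComplex A₁ ℤ ⥤ ChainComplex A₂ ℤ ⥤ ChainComplex A₃ ℤ :=
  S.T.map₂HomologicalComplex (ComplexShape.down ℤ) (ComplexShape.down ℤ) (ComplexShape.down ℤ)

/-- The class `tex(F)` of `F`-totally acyclic complexes: the exact, degreewise flat complexes
`K` in `A₂` such that `T(S⁰(E), K)` is exact for every injective object `E` of `A₁`. -/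
def tex [Abelian A₁] [Abelian A₂] [Abelian A₃] [HasColimits A₃]
    (S : BiadditiveTHC A₁ A₂ A₃) : ObjectProperty (ChainComplex A₂ ℤ) := fun K =>
  Cotorsion.ex S.flat₂ K ∧ ∀ E : A₁, Injective E →
    ((S.chainT.obj ((HomologicalComplex.single A₁ (ComplexShape.down ℤ) 0).obj E)).obj K).Acyclic

end BiadditiveTHC

/-! Write F for the flat objects of A₂. Only ⊥(tex(F)⊥) ⊆ tex(F) needs real work: it suffices to put
enough discs and spheres into tex(F)⊥ and to test X in ⊥(tex(F)⊥) against them.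

Discs on objects of F⊥ lie in tex(F)⊥, and chain maps X → Dⁿ(Y) are the maps Xₙ → Y. Hence Xₙ lies
in ⊥(F⊥), which is F because F⊥ contains all C(Q, I) with I injective (`flat₂_of_leftPerp`).

If Sⁿ(Y) lies in tex(F)⊥, lifting along Dⁿ(Y) → Sⁿ⁺¹(Y) shows that every map Xₙ₊₁ → Y killing
boundaries factors through d : Xₙ₊₁ → Xₙ. When Y contains Xₙ₊₁/Bₙ₊₁ this forces exactness at n + 1;
such Y exist in \underline{F⊥}. Taking Y = C(E, I) with I an injective containing T(E, X)ₙ₊₁ modulo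
boundaries gives exactness of T(E, X) in the same way. Both kinds of sphere lie in tex(F)⊥ thanks to
`mono_opcyclesMap_of_exactAt`. -/

namespace Cotorsion

variable {A : Type u} [Category.{v} A] [Abelian A]

/-! ### Orthogonality in an abelian category -/

/-- Every class is contained in the left orthogonal of its right orthogonal. -/
lemma le_leftPerp_rightPerp (K : ObjectProperty A) {X : A} (hX : K X) :
    leftPerp (rightPerp K) X := by
  intro S hS hY f
  have := hS.mono_f
  have := hS.epi_g
  let i : S.X₁ ⟶ pullback S.g f := pullback.lift S.f 0 (by simp)
  have hi₁ : i ≫ pullback.fst S.g f = S.f := pullback.lift_fst _ _ _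
  have hi₂ : i ≫ pullback.snd S.g f = 0 := pullback.lift_snd _ _ _
  have hi : Mono i := mono_of_mono_fac hi₁
  let P : ShortComplex A := ShortComplex.mk i (pullback.snd S.g f) hi₂
  have hP : P.Exact := by
    rw [ShortComplex.exact_iff_exact_up_to_refinements]
    intro B x hx
    obtain ⟨B', π, hπ, y, hy⟩ := hS.exact.exact_up_to_refinements (x ≫ pullback.fst S.g f)
      (by rw [Category.assoc, pullback.condition]; simpa using hx =≫ f)
    refine ⟨B', π, hπ, y, ?_⟩
    apply pullback.hom_ext
    · simpa [P, hi₁] using hy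
    · simpa [P, hi₂] using π ≫= hx
  have hPe : Epi P.g := inferInstanceAs (Epi (pullback.snd S.g f))
  -- The pulled-back sequence has quotient in `K` and kernel in `K^⊥`, so the identity of the kernel
  -- extends and the sequence splits; its section yields the lift.
  obtain ⟨r, hr⟩ := hY (ShortComplex.ShortExact.mk' hP hi hPe) hX (𝟙 _)
  let s := ShortComplex.Splitting.ofExactOfRetraction P hP r hr hPe
  refine ⟨s.s ≫ pullback.fst S.g f, ?_⟩
  have := s.s_g
  dsimp [P] at this
  simp only [Category.assoc, pullback.condition]
  simpa using this =≫ f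

/-- A monomorphism whose cokernel embeds in an object of the class `X` is orthogonal to the
objects of `\underline{Y}`. -/
lemma exists_extension_of_underlineRight {X Y : ObjectProperty A} {Y₀ : A}
    (hY : underlineRight X Y Y₀) {S : ShortComplex A} (hS : S.Exact) (hf : Mono S.f)
    (h₃ : X S.X₃) (φ : S.X₁ ⟶ Y₀) : ∃ ψ : S.X₂ ⟶ Y₀, S.f ≫ ψ = φ := by
  let p : pushout S.f φ ⟶ S.X₃ := pushout.desc S.g 0 (by simp)
  have hp₁ : pushout.inl S.f φ ≫ p = S.g := pushout.inl_desc _ _ _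
  have hp₂ : pushout.inr S.f φ ≫ p = 0 := pushout.inr_desc _ _ _
  have hex : (ShortComplex.mk (pushout.inr S.f φ) p hp₂).Exact := by
    rw [ShortComplex.exact_iff_exact_up_to_refinements]
    intro B x hx
    have hepi : Epi (biprod.desc (pushout.inl S.f φ) (pushout.inr S.f φ)) := by
      refine ⟨fun a b h => pushout.hom_ext ?_ ?_⟩
      · simpa using biprod.inl ≫= h
      · simpa using biprod.inr ≫= h
    obtain ⟨B₁, π₁, _, z, hz⟩ := surjective_up_to_refinements_of_epi
      (biprod.desc (pushout.inl S.f φ) (pushout.inr S.f φ)) x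
    obtain ⟨B₂, π₂, _, a, ha⟩ := hS.exact_up_to_refinements (z ≫ biprod.fst) (by
      have h₁ := π₁ ≫= hx
      dsimp at h₁
      rw [comp_zero, reassoc_of% hz] at h₁
      have h₂ : biprod.desc (pushout.inl S.f φ) (pushout.inr S.f φ) ≫ p
          = biprod.fst ≫ S.g := by
        ext <;> simp [hp₁, hp₂]
      rw [h₂] at h₁
      simpa using h₁)
    -- An element (z₁, z₂) of the pushout killed by `p` has z₁ = f(a), hence equals φ(a) + z₂, which
    -- comes from `Y₀`.
    refine ⟨B₂, π₂ ≫ π₁, epi_comp _ _, a ≫ φ + π₂ ≫ z ≫ biprod.snd, ?_⟩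
    dsimp
    rw [Category.assoc, hz, biprod.desc_eq]
    simp only [Preadditive.comp_add, Preadditive.add_comp, Category.assoc]
    rw [reassoc_of% ha, pushout.condition]
  have := hY.2 (pushout.inr S.f φ) p hp₂ inferInstance hex h₃
  refine ⟨pushout.inl S.f φ ≫ retraction (pushout.inr S.f φ), ?_⟩
  rw [pushout.condition_assoc]
  simp

end Cotorsion

/-! ### Quotients by boundaries -/

namespace ChainComplex

variable {A : Type u} [Category.{v} A] [Abelian A]

open HomologicalComplex

/-- A short exact sequence of complexes is short exact in each degree. -/
lemma shortExact_degree {S : ShortComplex (ChainComplex A ℤ)} (hS : S.ShortExact) (n : ℤ) :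
    (ShortComplex.mk (S.f.f n) (S.g.f n) (by rw [← comp_f, S.zero]; rfl)).ShortExact :=
  (shortExact_iff_degreewise_shortExact S).1 hS n

/-- If the quotient in a short exact sequence of complexes is exact in degree `n + 1`, then the
quotients by boundaries in degree `n` form a left exact sequence. -/
lemma mono_opcyclesMap_of_exactAt {S : ShortComplex (ChainComplex A ℤ)} (hS : S.ShortExact)
    (n : ℤ) (h : S.X₃.ExactAt (n + 1)) : Mono (opcyclesMap S.f n) := by
  -- Snake chase: if f(a) = db, then g(b) is a cycle, so g(b) = dc; lifting c to b' gives b - db' =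
  -- f(a'), whence a = da'.
  rw [Preadditive.mono_iff_cancel_zero]
  intro B x hx
  obtain ⟨B₁, π₁, _, a, ha⟩ := surjective_up_to_refinements_of_epi (S.X₁.pOpcycles n) x
  have h₁ : (a ≫ S.f.f n) ≫ S.X₂.pOpcycles n = 0 := by
    rw [Category.assoc, ← p_opcyclesMap, ← reassoc_of% ha, hx, comp_zero]
  obtain ⟨B₂, π₂, _, b, hb⟩ :=
    (S.X₂.comp_pOpcycles_eq_zero_iff_up_to_refinements _ (n + 1) (by simp)).1 h₁
  have h₂ : (b ≫ S.g.f (n + 1)) ≫ S.X₃.d (n + 1) n = 0 := by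
    rw [Category.assoc, S.g.comm, ← reassoc_of% hb, ← comp_f, S.zero]
    simp
  obtain ⟨B₃, π₃, _, c, hc⟩ := (S.X₃.exactAt_iff_exact_up_to_refinements (n + 1 + 1) (n + 1) n
    (by simp) (by simp)).1 h (b ≫ S.g.f (n + 1)) h₂
  have : Epi (S.g.f (n + 1 + 1)) := (shortExact_degree hS _).epi_g
  obtain ⟨B₄, π₄, _, b', hb'⟩ := surjective_up_to_refinements_of_epi (S.g.f (n + 1 + 1)) c
  obtain ⟨B₅, π₅, _, a', ha'⟩ := (shortExact_degree hS (n + 1)).exact.exact_up_to_refinements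
    (π₄ ≫ π₃ ≫ b - b' ≫ S.X₂.d _ _) (by
      dsimp
      rw [Preadditive.sub_comp, Category.assoc, Category.assoc, hc, reassoc_of% hb',
        Category.assoc, S.g.comm, sub_self])
  dsimp at a' ha'
  have : Mono (S.f.f n) := (shortExact_degree hS n).mono_f
  have h₃ : π₅ ≫ π₄ ≫ π₃ ≫ π₂ ≫ a = a' ≫ S.X₁.d (n + 1) n := by
    rw [← cancel_mono (S.f.f n)]
    simp only [Category.assoc]
    rw [hb, ← S.f.comm, ← reassoc_of% ha']
    simp
  rw [← cancel_epi π₁, ← cancel_epi π₂, ← cancel_epi π₃, ← cancel_epi π₄, ← cancel_epi π₅, ha]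
  simp [reassoc_of% h₃]

/-- A complex is exact in degree `n` as soon as some monomorphism on the quotient by boundaries
factors through the differential. -/
lemma exactAt_of_d_comp_eq (L : ChainComplex A ℤ) (n : ℤ) {Y : A} (j : L.opcycles (n + 1) ⟶ Y)
    [Mono j] (g : L.X n ⟶ Y) (hg : L.d (n + 1) n ≫ g = L.pOpcycles (n + 1) ≫ j) :
    L.ExactAt (n + 1) := by
  rw [L.exactAt_iff_exact_up_to_refinements (n + 1 + 1) (n + 1) n (by simp) (by simp)]
  intro B x hx
  refine (L.comp_pOpcycles_eq_zero_iff_up_to_refinements x (n + 1 + 1) (by simp)).1 ?_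
  rw [← cancel_mono j, Category.assoc, ← hg, reassoc_of% hx, zero_comp, zero_comp]

/-! ### Discs and spheres -/

lemma down_rel (n : ℤ) : (ComplexShape.down ℤ).Rel (n + 1) n := rfl

/-- The complex `Y = Y` in degrees `n + 1` and `n`. -/
noncomputable abbrev disc (n : ℤ) (Y : A) : ChainComplex A ℤ := double (𝟙 Y) (down_rel n)

lemma disc_ne (n : ℤ) : n + 1 ≠ n := by omega

open scoped Classical in
/-- The morphism to the disc determined by a morphism in the lower degree. -/
noncomputable def toDisc {K : ChainComplex A ℤ} {n : ℤ} {Y : A} (φ : K.X n ⟶ Y) :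
    K ⟶ disc n Y where
  f k :=
    if h₀ : k = n + 1 then
      eqToHom (by rw [h₀]) ≫ (K.d (n + 1) n ≫ φ) ≫ (doubleXIso₀ (𝟙 Y) (down_rel n)).inv ≫
        eqToHom (by rw [h₀])
    else if h₁ : k = n then
      eqToHom (by rw [h₁]) ≫ φ ≫ (doubleXIso₁ (𝟙 Y) (down_rel n) (disc_ne n)).inv ≫
        eqToHom (by rw [h₁])
    else 0
  comm' i j hij := by
    by_cases h₁ : j = n
    · subst h₁
      obtain rfl : i = j + 1 := hij.symm
      simp [double_d _ _ (disc_ne j)]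
    · rw [double_d_eq_zero₁ _ _ _ _ h₁, comp_zero]
      by_cases h₀ : j = n + 1
      · subst h₀
        simp
      · simp [h₀, h₁]

@[simp]
lemma toDisc_f₀ {K : ChainComplex A ℤ} {n : ℤ} {Y : A} (φ : K.X n ⟶ Y) :
    (toDisc φ).f (n + 1) = K.d (n + 1) n ≫ φ ≫ (doubleXIso₀ (𝟙 Y) (down_rel n)).inv := by
  simp [toDisc]

@[simp]
lemma toDisc_f₁ {K : ChainComplex A ℤ} {n : ℤ} {Y : A} (φ : K.X n ⟶ Y) :
    (toDisc φ).f n = φ ≫ (doubleXIso₁ (𝟙 Y) (down_rel n) (disc_ne n)).inv := by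
  simp [toDisc]

/-- The differential of the disc is invertible, so degree `n` determines a map. With `toDisc`, this
makes the disc right adjoint to evaluation in degree `n`. -/
lemma to_disc_hom_ext {K : ChainComplex A ℤ} {n : ℤ} {Y : A} {f g : K ⟶ disc n Y}
    (h : f.f n = g.f n) : f = g := by
  apply to_double_hom_ext _ h
  have : IsIso ((disc n Y).d (n + 1) n) := by
    rw [double_d _ _ (disc_ne n)]; infer_instance
  rw [← cancel_mono ((disc n Y).d (n + 1) n), f.comm, g.comm, h]

/-- The morphism of discs induced by a morphism. -/
noncomputable abbrev discMap (n : ℤ) {Y Z : A} (h : Y ⟶ Z) : disc n Y ⟶ disc n Z :=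
  toDisc ((doubleXIso₁ (𝟙 Y) (down_rel n) (disc_ne n)).hom ≫ h)

lemma inv_discMap_f₀ (n : ℤ) {Y Z : A} (h : Y ⟶ Z) :
    (doubleXIso₀ (𝟙 Y) (down_rel n)).inv ≫ (discMap n h).f (n + 1) =
      h ≫ (doubleXIso₀ (𝟙 Z) (down_rel n)).inv := by
  rw [toDisc_f₀, double_d _ _ (disc_ne n)]
  simp

lemma inv_discMap_f₁ (n : ℤ) {Y Z : A} (h : Y ⟶ Z) :
    (doubleXIso₁ (𝟙 Y) (down_rel n) (disc_ne n)).inv ≫ (discMap n h).f n =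
      h ≫ (doubleXIso₁ (𝟙 Z) (down_rel n) (disc_ne n)).inv := by
  simp

lemma shortExact_of_isZero {S : ShortComplex A} (h₁ : IsZero S.X₁) (h₂ : IsZero S.X₂)
    (h₃ : IsZero S.X₃) : S.ShortExact :=
  ShortComplex.ShortExact.mk' (S.exact_of_isZero_X₂ h₂) ⟨fun _ _ _ => h₁.eq_of_tgt _ _⟩
    ⟨fun _ _ _ => h₃.eq_of_src _ _⟩

/-- Discs form exact sequences. -/
lemma disc_shortExact (n : ℤ) {S : ShortComplex A} (hS : S.ShortExact) :
    (ShortComplex.mk (discMap n S.f) (discMap n S.g)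
      (to_disc_hom_ext (by simp))).ShortExact := by
  apply shortExact_of_degreewise_shortExact
  intro k
  by_cases h₀ : k = n + 1
  · subst h₀
    refine ShortComplex.shortExact_of_iso (ShortComplex.isoMk
      (doubleXIso₀ (𝟙 S.X₁) (down_rel n)).symm (doubleXIso₀ (𝟙 S.X₂) (down_rel n)).symm
      (doubleXIso₀ (𝟙 S.X₃) (down_rel n)).symm ?_ ?_) hS
    · exact inv_discMap_f₀ n S.f
    · exact inv_discMap_f₀ n S.g
  · by_cases h₁ : k = n
    · subst h₁
      refine ShortComplex.shortExact_of_iso (ShortComplex.isoMk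
        (doubleXIso₁ (𝟙 S.X₁) (down_rel k) (disc_ne k)).symm
        (doubleXIso₁ (𝟙 S.X₂) (down_rel k) (disc_ne k)).symm
        (doubleXIso₁ (𝟙 S.X₃) (down_rel k) (disc_ne k)).symm ?_ ?_) hS
      · exact inv_discMap_f₁ k S.f
      · exact inv_discMap_f₁ k S.g
    · have hz : ∀ Y : A, IsZero ((disc n Y).X k) := fun Y =>
        isZero_double_X (𝟙 Y) (down_rel n) k h₀ h₁
      exact shortExact_of_isZero (hz _) (hz _) (hz _)

/-- The complex concentrated in degree `n`. -/
noncomputable abbrev sphere (n : ℤ) (Y : A) : ChainComplex A ℤ :=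
  (single A (ComplexShape.down ℤ) n).obj Y

/-- The sphere in degree `n` as a subobject of the disc. -/
noncomputable def sphereToDisc (n : ℤ) (Y : A) : sphere n Y ⟶ disc n Y :=
  toDisc (singleObjXSelf (ComplexShape.down ℤ) n Y).hom

/-- The sphere in degree `n + 1` as a quotient of the disc. -/
noncomputable def discToSphere (n : ℤ) (Y : A) : disc n Y ⟶ sphere (n + 1) Y :=
  mkHomToSingle (doubleXIso₀ (𝟙 Y) (down_rel n)).hom
    (fun i _ => by rw [double_d_eq_zero₁ _ _ _ _ (disc_ne n), zero_comp])

lemma sphere_disc_shortExact (n : ℤ) (Y : A) :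
    (ShortComplex.mk (sphereToDisc n Y) (discToSphere n Y)
      (to_single_hom_ext ((isZero_single_obj_X (ComplexShape.down ℤ) n Y (n + 1)
        (disc_ne n)).eq_of_src _ _))).ShortExact := by
  apply shortExact_of_degreewise_shortExact
  intro k
  by_cases h₀ : k = n + 1
  · subst h₀
    have hz : IsZero ((sphere n Y).X (n + 1)) := isZero_single_obj_X _ _ _ _ (disc_ne n)
    have : IsIso ((discToSphere n Y).f (n + 1)) := by
      simp only [discToSphere, mkHomToSingle_f]; infer_instance
    exact ShortComplex.ShortExact.mk'
      ((ShortComplex.exact_iff_mono _ (hz.eq_of_src _ _)).2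
        (inferInstanceAs (Mono ((discToSphere n Y).f (n + 1)))))
      ⟨fun _ _ _ => hz.eq_of_tgt _ _⟩ (inferInstanceAs (Epi ((discToSphere n Y).f (n + 1))))
  · by_cases h₁ : k = n
    · subst h₁
      have hz : IsZero ((sphere (k + 1) Y).X k) :=
        isZero_single_obj_X _ _ _ _ (disc_ne k).symm
      have : IsIso ((sphereToDisc k Y).f k) := by
        simp only [sphereToDisc, toDisc_f₁]; infer_instance
      exact ShortComplex.ShortExact.mk'
        ((ShortComplex.exact_iff_epi _ (hz.eq_of_tgt _ _)).2
          (inferInstanceAs (Epi ((sphereToDisc k Y).f k))))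
        (inferInstanceAs (Mono ((sphereToDisc k Y).f k)))
        ⟨fun _ _ _ => hz.eq_of_src _ _⟩
    · exact shortExact_of_isZero (isZero_single_obj_X (.down ℤ) n Y k h₁)
        (isZero_double_X (𝟙 Y) (down_rel n) k h₀ h₁)
        (isZero_single_obj_X (.down ℤ) (n + 1) Y k h₀)

end ChainComplex

/-! ### Testing orthogonality with discs and spheres -/

namespace Cotorsion

variable {A : Type u} [Category.{v} A] [Abelian A]

open HomologicalComplex ChainComplex

/-- A disc on an object of `F^⊥` is orthogonal to the complexes that are degreewise in `F`. -/
lemma rightPerp_disc {F : ObjectProperty A} {K : ObjectProperty (ChainComplex A ℤ)}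
    (hK : ∀ X, K X → ∀ n, F (X.X n)) {Y : A} (hY : rightPerp F Y) (n : ℤ) :
    rightPerp K (disc n Y) := by
  intro S hS hX φ
  obtain ⟨ψ, hψ⟩ := hY (shortExact_degree hS n) (hK _ hX n)
    (φ.f n ≫ (doubleXIso₁ (𝟙 Y) (down_rel n) (disc_ne n)).hom)
  dsimp at ψ hψ
  exact ⟨toDisc ψ, to_disc_hom_ext (by simp only [comp_f, toDisc_f₁, reassoc_of% hψ]; simp)⟩

/-- By adjunction, lifting `X.X n` along an epimorphism is lifting `X` along the induced map of
discs, whose kernel is again a disc. -/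
lemma leftPerp_X_of_disc {F : ObjectProperty A} {K : ObjectProperty (ChainComplex A ℤ)}
    (n : ℤ) (hK : ∀ Y, F Y → K (disc n Y)) {X : ChainComplex A ℤ} (hX : leftPerp K X) :
    leftPerp F (X.X n) := by
  intro S hS hY φ
  obtain ⟨ψ, hψ⟩ := hX (disc_shortExact n hS) (hK _ hY) (toDisc φ)
  refine ⟨ψ.f n ≫ (doubleXIso₁ (𝟙 S.X₂) (down_rel n) (disc_ne n)).hom, ?_⟩
  have := congr_hom hψ n
  simpa [← cancel_mono (doubleXIso₁ (𝟙 S.X₃) (down_rel n) (disc_ne n)).inv] using this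

/-- A sphere is orthogonal to a class of complexes if the morphisms vanishing on boundaries
extend. -/
lemma rightPerp_sphere {K : ObjectProperty (ChainComplex A ℤ)} {Y : A} (n : ℤ)
    (h : ∀ ⦃S : ShortComplex (ChainComplex A ℤ)⦄, S.ShortExact → K S.X₃ →
      ∀ φ : S.X₁.X n ⟶ Y, S.X₁.d (n + 1) n ≫ φ = 0 →
        ∃ ψ : S.X₂.X n ⟶ Y, S.X₂.d (n + 1) n ≫ ψ = 0 ∧ S.f.f n ≫ ψ = φ) :
    rightPerp K (sphere n Y) := by
  intro S hS hX φ
  obtain ⟨ψ, hψ, h'⟩ := h hS hX (φ.f n ≫ (singleObjXSelf _ n Y).hom)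
    (by rw [← φ.comm_assoc]; simp)
  exact ⟨mkHomToSingle ψ (by rintro i rfl; exact hψ),
    to_single_hom_ext (by simp [reassoc_of% h'])⟩

/-- Such a `φ` is a chain map to the sphere in degree `n + 1`. The lower component of a lift to the
disc is the required `g`. -/
lemma exists_d_comp_eq_of_leftPerp {K : ObjectProperty (ChainComplex A ℤ)}
    {X : ChainComplex A ℤ} (hX : leftPerp K X) {Y : A} {n : ℤ} (hY : K (sphere n Y))
    (φ : X.X (n + 1) ⟶ Y) (hφ : X.d (n + 1 + 1) (n + 1) ≫ φ = 0) :
    ∃ g : X.X n ⟶ Y, X.d (n + 1) n ≫ g = φ := by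
  obtain ⟨ψ, hψ⟩ := hX (sphere_disc_shortExact n Y) hY
    (mkHomToSingle φ (by rintro i rfl; exact hφ))
  refine ⟨ψ.f n ≫ (doubleXIso₁ (𝟙 Y) (down_rel n) (disc_ne n)).hom, ?_⟩
  have h₁ := congr_hom hψ (n + 1)
  have h₂ : ψ.f (n + 1) ≫ (doubleXIso₀ (𝟙 Y) (down_rel n)).hom = φ := by
    simpa [discToSphere, ← cancel_mono (singleObjXSelf (ComplexShape.down ℤ) (n + 1) Y).inv]
      using h₁
  rw [← ψ.comm_assoc, double_d _ _ (disc_ne n), ← h₂]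
  simp

end Cotorsion

/-! ### Flatness and the functors T and C -/

namespace BiadditiveTHC

variable {A₁ : Type u₁} {A₂ : Type u₂} {A₃ : Type u₃}
  [Category.{v₁} A₁] [Category.{v₂} A₂] [Category.{v₃} A₃]

section

variable [Preadditive A₁] [Preadditive A₂] [Preadditive A₃] (S : BiadditiveTHC A₁ A₂ A₃)

instance (X₂ : A₂) : (S.T.flip.obj X₂).Additive where
  map_add {X Y f g} := by simp

instance (X₁ : A₁) : (S.T.obj X₁).IsLeftAdjoint := (S.adjC.adj X₁).isLeftAdjoint

instance (X₂ : A₂) : (S.T.flip.obj X₂).IsLeftAdjoint := (S.adjH.adj X₂).isLeftAdjoint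

end

variable [Abelian A₁] [Abelian A₂] [Abelian A₃] (S : BiadditiveTHC A₁ A₂ A₃)

lemma exact_T_right (X₁ : A₁) {Q : ShortComplex A₂} (hQ : Q.Exact) [Epi Q.g] :
    (ShortComplex.mk ((S.T.obj X₁).map Q.f) ((S.T.obj X₁).map Q.g)
      (by rw [← Functor.map_comp, Q.zero, Functor.map_zero])).Exact :=
  hQ.map_of_epi_of_preservesCokernel (S.T.obj X₁) inferInstance inferInstance

lemma exact_T_left (X₂ : A₂) {Q : ShortComplex A₁} (hQ : Q.Exact) [Epi Q.g] :
    (ShortComplex.mk ((S.T.map Q.f).app X₂) ((S.T.map Q.g).app X₂)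
      (by rw [← NatTrans.comp_app, ← Functor.map_comp, Q.zero, Functor.map_zero]; rfl)).Exact :=
  hQ.map_of_epi_of_preservesCokernel (S.T.flip.obj X₂) inferInstance inferInstance

/-- A monomorphism with flat cokernel is preserved by all the functors `T(Q, -)`. -/
lemma mono_T_map_of_flat (hflat₁ : Cotorsion.EnoughQuot S.flat₁) {P : ShortComplex A₂}
    (hP : P.ShortExact) (h₃ : S.flat₂ P.X₃) (Q : A₁) : Mono ((S.T.obj Q).map P.f) := by
  have := hP.mono_f
  have := hP.epi_g
  -- In effect Tor₁(Q, P₃) = 0. The chase compares T(ker p, -), T(F, -) and T(Q, -): flatness of P₃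
  -- moves `b` back to T(ker p, P₁), and flatness of F identifies its image there with `a`.
  obtain ⟨F, p, hF, _⟩ := hflat₁ Q
  have hF' : (S.T.obj F).PreservesMonomorphisms := hF
  have h₃' : (S.T.flip.obj P.X₃).PreservesMonomorphisms := h₃
  have hk : (ShortComplex.mk (kernel.ι p) p (kernel.condition p)).Exact :=
    ShortComplex.kernelSequence_exact p
  have : Mono ((S.T.map (kernel.ι p)).app P.X₃) :=
    inferInstanceAs (Mono ((S.T.flip.obj P.X₃).map (kernel.ι p)))
  have : Epi ((S.T.map p).app P.X₁) :=
    inferInstanceAs (Epi ((S.T.flip.obj P.X₁).map p))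
  have hz : (S.T.obj F).map P.f ≫ (S.T.obj F).map P.g = 0 := by
    rw [← Functor.map_comp, P.zero, Functor.map_zero]
  rw [Preadditive.mono_iff_cancel_zero]
  intro B x hx
  obtain ⟨B₁, π₁, _, a, ha⟩ := surjective_up_to_refinements_of_epi ((S.T.map p).app P.X₁) x
  obtain ⟨B₂, π₂, _, b, hb⟩ := (S.exact_T_left P.X₂ hk).exact_up_to_refinements
    (a ≫ (S.T.obj F).map P.f) (by
      dsimp
      rw [Category.assoc, NatTrans.naturality, ← reassoc_of% ha, hx, comp_zero])
  dsimp at b hb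
  obtain ⟨B₃, π₃, _, a', ha'⟩ := (S.exact_T_right (kernel p) hP.exact).exact_up_to_refinements b
    (by
      dsimp
      rw [← cancel_mono ((S.T.map (kernel.ι p)).app P.X₃), Category.assoc, NatTrans.naturality,
        ← reassoc_of% hb, hz]
      simp)
  dsimp at a' ha'
  have h : π₃ ≫ π₂ ≫ a = a' ≫ (S.T.map (kernel.ι p)).app P.X₁ := by
    rw [← cancel_mono ((S.T.obj F).map P.f)]
    simp only [Category.assoc]
    rw [hb, reassoc_of% ha', ← NatTrans.naturality]
  rw [← cancel_epi π₁, ← cancel_epi π₂, ← cancel_epi π₃, ha, reassoc_of% h, ← NatTrans.comp_app,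
    ← Functor.map_comp, kernel.condition]
  simp

/-- The objects `C(Q, I)` with `I` injective are orthogonal to the flat objects. -/
lemma rightPerp_flat₂_C (hflat₁ : Cotorsion.EnoughQuot S.flat₁) (Q : A₁) (I : A₃) [Injective I] :
    Cotorsion.rightPerp S.flat₂ ((S.C.obj (op Q)).obj I) := by
  intro P hP h₃ φ
  have := S.mono_T_map_of_flat hflat₁ hP h₃ Q
  refine ⟨S.adjC.homEquiv (Injective.factorThru (S.adjC.homEquiv.symm φ)
    ((S.T.obj Q).map P.f)), ?_⟩
  dsimp
  rw [← S.adjC.homEquiv_naturality_two, Injective.comp_factorThru, Equiv.apply_symm_apply]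

/-- Additivity is assumed for T only, so the vanishing is transported through the adjunction. -/
lemma zero_C_map (I : A₃) {M : ShortComplex A₁} :
    (S.C.map M.g.op).app I ≫ (S.C.map M.f.op).app I = 0 := by
  apply S.adjC.homEquiv.symm.injective
  rw [S.adjC.homEquiv_symm_naturality_one]
  have h₁ := S.adjC.homEquiv_symm_naturality_one M.g
    (𝟙 ((S.C.obj (op M.X₃)).obj I))
  rw [Category.id_comp] at h₁
  have h₂ := S.adjC.homEquiv_symm_naturality_two
    (0 : (S.C.obj (op M.X₃)).obj I ⟶ (S.C.obj (op M.X₁)).obj I) (𝟙 _)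
  rw [Category.comp_id] at h₂
  rw [h₁, h₂, ← NatTrans.comp_app_assoc, ← Functor.map_comp, M.zero]
  simp

/-- The functor `C(-, I)` with `I` injective is exact. -/
lemma shortExact_C (hflat₂ : Cotorsion.EnoughQuot S.flat₂) (I : A₃) [Injective I]
    {M : ShortComplex A₁} (hM : M.ShortExact) :
    (ShortComplex.mk ((S.C.map M.g.op).app I) ((S.C.map M.f.op).app I)
      (S.zero_C_map I)).ShortExact := by
  have := hM.mono_f
  have := hM.epi_g
  refine ShortComplex.ShortExact.mk' ?_ ?_ ?_
  · rw [ShortComplex.exact_iff_exact_up_to_refinements]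
    intro B x hx
    dsimp at x hx
    have h₀ : (S.T.map M.f).app B ≫ S.adjC.homEquiv.symm x = 0 := by
      rw [← S.adjC.homEquiv_symm_naturality_one, hx]
      have h₂ := S.adjC.homEquiv_symm_naturality_two
        (0 : B ⟶ (S.C.obj (op M.X₁)).obj I) (𝟙 _)
      simpa using h₂
    have : Epi ((S.T.map M.g).app B) := inferInstanceAs (Epi ((S.T.flip.obj B).map M.g))
    obtain ⟨l, hl⟩ := (S.exact_T_left B hM.exact).desc' (S.adjC.homEquiv.symm x) h₀
    refine ⟨B, 𝟙 B, inferInstance, S.adjC.homEquiv l, ?_⟩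
    dsimp
    rw [← S.adjC.homEquiv_naturality_one, Category.id_comp, ← Equiv.symm_apply_eq]
    exact hl.symm
  · refine ⟨fun {B} a b h => S.adjC.homEquiv.symm.injective ?_⟩
    have : Epi ((S.T.map M.g).app B) := inferInstanceAs (Epi ((S.T.flip.obj B).map M.g))
    rw [← cancel_epi ((S.T.map M.g).app B), ← S.adjC.homEquiv_symm_naturality_one,
      ← S.adjC.homEquiv_symm_naturality_one]
    exact congrArg _ h
  -- A flat cover of the target suffices: the transpose T(M₁, F) → I of `p` extends along the
  -- monomorphism T(M₁, F) → T(M₂, F), so `p` factors through the map.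
  · obtain ⟨F, p, hF, _⟩ := hflat₂ ((S.C.obj (op M.X₁)).obj I)
    have hF' : (S.T.flip.obj F).PreservesMonomorphisms := hF
    have : Mono ((S.T.map M.f).app F) := inferInstanceAs (Mono ((S.T.flip.obj F).map M.f))
    have h : S.adjC.homEquiv (Injective.factorThru (S.adjC.homEquiv.symm p)
        ((S.T.map M.f).app F)) ≫ (S.C.map M.f.op).app I = p := by
      rw [← S.adjC.homEquiv_naturality_one, Injective.comp_factorThru, Equiv.apply_symm_apply]
    exact epi_of_epi_fac h

/-- The flat objects form the left class of a cotorsion theory. -/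
lemma flat₂_of_leftPerp (hflat₁ : Cotorsion.EnoughQuot S.flat₁)
    (hflat₂ : Cotorsion.EnoughQuot S.flat₂) (hinj₃ : EnoughInjectives A₃) {P : A₂}
    (hP : Cotorsion.leftPerp (Cotorsion.rightPerp S.flat₂) P) : S.flat₂ P where
  preserves {M N} m _ := by
    have hM := ShortComplex.ShortExact.mk'
      (S := ShortComplex.mk m (cokernel.π m) (cokernel.condition m))
      (ShortComplex.cokernelSequence_exact m) inferInstance inferInstance
    -- Lifting the transpose of this embedding along C(N, I) → C(M, I), whose kernel C(coker m, I)
    -- lies in F⊥, factors `j` through T(m, P).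
    let j := Injective.ι ((S.T.obj M).obj P)
    obtain ⟨ψ, hψ⟩ := hP (S.shortExact_C hflat₂ (Injective.under ((S.T.obj M).obj P)) hM)
      (S.rightPerp_flat₂_C hflat₁ _ _) (S.adjC.homEquiv j)
    dsimp at ψ hψ
    have h : (S.T.map m).app P ≫ S.adjC.homEquiv.symm ψ = j := by
      rw [← S.adjC.homEquiv_symm_naturality_one, hψ, Equiv.symm_apply_apply]
    have : Mono ((S.T.map m).app P) := mono_of_mono_fac h
    exact this

end BiadditiveTHC

/-! ### The complexes T(S⁰(E), K) -/

namespace BiadditiveTHC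

variable {A₁ : Type u₁} {A₂ : Type u₂} {A₃ : Type u₃}
  [Category.{v₁} A₁] [Category.{v₂} A₂] [Category.{v₃} A₃]
  [Abelian A₁] [Abelian A₂] [Abelian A₃] (S : BiadditiveTHC A₁ A₂ A₃)

open HomologicalComplex ChainComplex

/-- The functor `T(E, -)` applied degreewise to a complex. -/
noncomputable abbrev mapT (E : A₁) : ChainComplex A₂ ℤ ⥤ ChainComplex A₃ ℤ :=
  (S.T.obj E).mapHomologicalComplex (ComplexShape.down ℤ)

lemma isZero_T_sphere (E : A₁) {p : ℤ} (hp : p ≠ 0) (X₂ : A₂) :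
    IsZero ((S.T.obj ((sphere 0 E).X p)).obj X₂) :=
  (S.T.flip.obj X₂).map_isZero (isZero_single_obj_X (ComplexShape.down ℤ) 0 E p hp)

section

variable [HasColimits A₃] (E : A₁) (K : ChainComplex A₂ ℤ)

/-- The inclusion of the only nonzero summand of `T(S⁰(E), K)ₙ`. -/
noncomputable def ιSphere (n : ℤ) :
    (S.T.obj E).obj (K.X n) ⟶ (mapBifunctor (sphere 0 E) K S.T (ComplexShape.down ℤ)).X n :=
  (S.T.map (singleObjXSelf (ComplexShape.down ℤ) 0 E).inv).app (K.X n) ≫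
    ιMapBifunctor (sphere 0 E) K S.T (ComplexShape.down ℤ) 0 n n (zero_add n)

open scoped Classical in
/-- The projection to the only nonzero summand of `T(S⁰(E), K)ₙ`. -/
noncomputable def πSphere (n : ℤ) :
    (mapBifunctor (sphere 0 E) K S.T (ComplexShape.down ℤ)).X n ⟶ (S.T.obj E).obj (K.X n) :=
  mapBifunctorDesc (fun p q h =>
    if hp : p = 0 then
      (S.T.map (singleObjXIsoOfEq (ComplexShape.down ℤ) 0 E p hp).hom).app (K.X q) ≫
        (S.T.obj E).map (K.XIsoOfEq (show q = n by
          subst hp; exact (zero_add q).symm.trans h)).hom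
    else 0)

lemma isIso_ιSphere (n : ℤ) : IsIso (S.ιSphere E K n) := by
  refine ⟨S.πSphere E K n, ?_, ?_⟩
  · simp only [ιSphere, πSphere, Category.assoc, ι_mapBifunctorDesc]
    simp [singleObjXSelf]
  · apply mapBifunctor.hom_ext
    intro p q h
    by_cases hp : p = 0
    · subst hp
      obtain rfl : q = n := (zero_add q).symm.trans h
      rw [πSphere, ι_mapBifunctorDesc_assoc]
      simp [ιSphere, singleObjXSelf, ← NatTrans.comp_app_assoc, ← Functor.map_comp]
    · exact (S.isZero_T_sphere E hp _).eq_of_src _ _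

/-- The sphere has zero differential, and the remaining term carries the sign (-1)⁰ = 1. -/
lemma ιSphere_d (n : ℤ) :
    S.ιSphere E K (n + 1) ≫
        (mapBifunctor (sphere 0 E) K S.T (ComplexShape.down ℤ)).d (n + 1) n =
      (S.T.obj E).map (K.d (n + 1) n) ≫ S.ιSphere E K n := by
  have h₁ : mapBifunctor.d₁ (sphere 0 E) K S.T (ComplexShape.down ℤ) 0 (n + 1) n = 0 := by
    rw [mapBifunctor.d₁_eq _ _ _ _ (i₁' := -1) (by rfl) _ _ (by
      change -1 + (n + 1) = n; omega)]
    simp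
  have h₂ : mapBifunctor.d₂ (sphere 0 E) K S.T (ComplexShape.down ℤ) 0 (n + 1) n =
      (S.T.obj _).map (K.d (n + 1) n) ≫
        ιMapBifunctor (sphere 0 E) K S.T (ComplexShape.down ℤ) 0 n n (zero_add n) := by
    rw [mapBifunctor.d₂_eq _ _ _ _ _ (down_rel n) _ (zero_add n)]
    simp
  rw [ιSphere, ιSphere, Category.assoc, mapBifunctor.d_eq, Preadditive.comp_add,
    mapBifunctor.ι_D₁, mapBifunctor.ι_D₂, h₁, h₂, zero_add]
  simp

/-- The complex `T(S⁰(E), K)` is `T(E, -)` applied degreewise to `K`. -/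
noncomputable def chainTSphereIso :
    (S.mapT E).obj K ≅ (S.chainT.obj (sphere 0 E)).obj K :=
  Hom.isoOfComponents (fun n =>
    @asIso _ _ _ _ (S.ιSphere E K n) (S.isIso_ιSphere E K n)) (by
    rintro _ n rfl
    exact S.ιSphere_d E K n)

end

/-- Applying `T(E, -)` to a short exact sequence of complexes with degreewise flat cokernel. -/
lemma shortExact_mapT (hflat₁ : Cotorsion.EnoughQuot S.flat₁)
    {P : ShortComplex (ChainComplex A₂ ℤ)} (hP : P.ShortExact)
    (h₃ : ∀ n, S.flat₂ (P.X₃.X n)) (E : A₁) : (P.map (S.mapT E)).ShortExact := by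
  apply shortExact_of_degreewise_shortExact
  intro n
  have hn := shortExact_degree hP n
  have : Epi (P.g.f n) := hn.epi_g
  exact ShortComplex.ShortExact.mk' (S.exact_T_right E hn.exact)
    (S.mono_T_map_of_flat hflat₁ hn (h₃ n) E)
    (inferInstanceAs (Epi ((S.T.obj E).map (P.g.f n))))

lemma tex_iff [HasColimits A₃] (K : ChainComplex A₂ ℤ) :
    S.tex K ↔ Cotorsion.ex S.flat₂ K ∧
      ∀ E : A₁, Injective E → ((S.mapT E).obj K).Acyclic := by
  refine and_congr_right fun _ => forall₂_congr fun E _ => ?_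
  exact ⟨fun h n => (h n).of_iso (S.chainTSphereIso E K).symm,
    fun h n => (h n).of_iso (S.chainTSphereIso E K)⟩

/-! ### Spheres orthogonal to tex(F), and the exactness they detect -/

variable [HasColimits A₃]

/-- Modulo boundaries in degree n, the inclusion stays monic, with cokernel X₃,ₙ/Bₙ. Exactness
embeds this cokernel in the flat object X₃,ₙ₋₁; it need not be flat itself, hence the underlined
class. -/
lemma rightPerp_tex_sphere_of_underlineRight {Y : A₂} {Y' : ObjectProperty A₂}
    (hY : Cotorsion.underlineRight S.flat₂ Y' Y) (n : ℤ) :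
    Cotorsion.rightPerp S.tex (sphere n Y) := by
  apply Cotorsion.rightPerp_sphere
  intro P hP hX φ hφ
  have hmono := mono_opcyclesMap_of_exactAt hP n (hX.1.1 _)
  obtain ⟨m, rfl⟩ : ∃ m, n = m + 1 := ⟨n - 1, by omega⟩
  have hEpi := hP.epi_g
  have hfrom : Mono (P.X₃.fromOpcycles (m + 1) m) := by
    have := hX.1.1 (m + 1)
    rw [P.X₃.exactAt_iff_exact_up_to_refinements (m + 1 + 1) (m + 1) m (by simp) (by simp)] at this
    rw [Preadditive.mono_iff_cancel_zero]
    intro B x hx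
    obtain ⟨B₁, π₁, _, a, ha⟩ := surjective_up_to_refinements_of_epi (P.X₃.pOpcycles (m + 1)) x
    obtain ⟨B₂, π₂, _, b, hb⟩ := this a (by
      rw [← p_fromOpcycles, ← reassoc_of% ha, hx, comp_zero])
    rw [← cancel_epi π₁, ← cancel_epi π₂, ha, reassoc_of% hb, d_pOpcycles]
    simp
  have hex := opcycles_right_exact P hP.exact (m + 1)
  have hex' : (ShortComplex.mk (opcyclesMap P.f (m + 1))
      (opcyclesMap P.g (m + 1) ≫ P.X₃.fromOpcycles (m + 1) m)
      (by rw [← Category.assoc, ← opcyclesMap_comp, P.zero, opcyclesMap_zero, zero_comp])).Exact := by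
    rw [ShortComplex.exact_iff_exact_up_to_refinements] at hex ⊢
    intro B x hx
    exact hex x (by
      rw [← cancel_mono (P.X₃.fromOpcycles (m + 1) m)]
      simpa using hx)
  obtain ⟨ψ, hψ⟩ := Cotorsion.exists_extension_of_underlineRight hY hex' hmono (hX.1.2 m)
    (P.X₁.descOpcycles φ _ (by simp) hφ)
  refine ⟨P.X₂.pOpcycles (m + 1) ≫ ψ, by simp, ?_⟩
  dsimp at hψ
  rw [← p_opcyclesMap_assoc, hψ, p_descOpcycles]

/-- After transposing, a map T(E, X₁)ₙ/Bₙ → I must be extended. Flatness of X₃ keeps T(E, -) short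
exact, exactness of T(E, X₃) keeps the map of quotients monic, and I is injective. -/
lemma rightPerp_tex_sphere_C (hflat₁ : Cotorsion.EnoughQuot S.flat₁) (E : A₁) [hE : Injective E]
    (I : A₃) [Injective I] (n : ℤ) :
    Cotorsion.rightPerp S.tex (sphere n ((S.C.obj (op E)).obj I)) := by
  apply Cotorsion.rightPerp_sphere
  intro P hP hX φ hφ
  rw [tex_iff] at hX
  have hmono := mono_opcyclesMap_of_exactAt (S.shortExact_mapT hflat₁ hP hX.1.2 E) n
    (hX.2 E hE (n + 1))
  have hφ' : (S.T.obj E).map (P.X₁.d (n + 1) n) ≫ S.adjC.homEquiv.symm φ = 0 := by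
    rw [← S.adjC.homEquiv_symm_naturality_two, hφ,
      ← zero_comp (Y := P.X₁.X n) (f := φ), S.adjC.homEquiv_symm_naturality_two,
      Functor.map_zero, zero_comp]
  let L₁ := (S.mapT E).obj P.X₁
  let L₂ := (S.mapT E).obj P.X₂
  let f : L₁ ⟶ L₂ := (S.mapT E).map P.f
  have hf : Mono (opcyclesMap f n) := hmono
  let α : L₁.opcycles n ⟶ I := L₁.descOpcycles (S.adjC.homEquiv.symm φ) (n + 1) (by simp) hφ'
  let β : (S.T.obj E).obj (P.X₂.X n) ⟶ I :=
    L₂.pOpcycles n ≫ Injective.factorThru α (opcyclesMap f n)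
  have hβ : (S.T.obj E).map (P.X₂.d (n + 1) n) ≫ β = 0 := by
    have := L₂.d_pOpcycles (n + 1) n =≫ Injective.factorThru α (opcyclesMap f n)
    rw [Category.assoc, zero_comp] at this
    exact this
  have hfβ : (S.T.obj E).map (P.f.f n) ≫ β = S.adjC.homEquiv.symm φ := by
    have := p_opcyclesMap f n =≫ Injective.factorThru α (opcyclesMap f n)
    rw [Category.assoc, Injective.comp_factorThru, Category.assoc] at this
    exact this.symm.trans (L₁.p_descOpcycles _ _ _ _)
  refine ⟨S.adjC.homEquiv β, ?_, ?_⟩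
  · rw [← S.adjC.homEquiv_naturality_two, hβ, ← zero_comp (X := (S.T.obj E).obj (P.X₂.X (n + 1)))
      (f := β), ← Functor.map_zero (S.T.obj E), S.adjC.homEquiv_naturality_two, zero_comp]
  · rw [← S.adjC.homEquiv_naturality_two, hfβ, Equiv.apply_symm_apply]

/-- Exactness of complexes in the left orthogonal of `tex(F)^⊥`. -/
lemma acyclic_of_leftPerp
    (hperp : Cotorsion.EnoughSub
      (Cotorsion.underlineRight S.flat₂ (Cotorsion.rightPerp S.flat₂)))
    {X : ChainComplex A₂ ℤ} (hX : Cotorsion.leftPerp (Cotorsion.rightPerp S.tex) X) :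
    X.Acyclic := by
  intro n
  obtain ⟨m, rfl⟩ : ∃ m, n = m + 1 := ⟨n - 1, by omega⟩
  obtain ⟨Y, j, hY, _⟩ := hperp (X.opcycles (m + 1))
  obtain ⟨g, hg⟩ := Cotorsion.exists_d_comp_eq_of_leftPerp hX
    (S.rightPerp_tex_sphere_of_underlineRight hY m) (X.pOpcycles (m + 1) ≫ j) (by simp)
  exact X.exactAt_of_d_comp_eq m j g hg

/-- Exactness of `T(E, X)` for complexes `X` in the left orthogonal of `tex(F)^⊥`. -/
lemma acyclic_mapT_of_leftPerp (hflat₁ : Cotorsion.EnoughQuot S.flat₁)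
    (hinj₃ : EnoughInjectives A₃) (E : A₁) [Injective E]
    {X : ChainComplex A₂ ℤ} (hX : Cotorsion.leftPerp (Cotorsion.rightPerp S.tex) X) :
    ((S.mapT E).obj X).Acyclic := by
  intro n
  obtain ⟨m, rfl⟩ : ∃ m, n = m + 1 := ⟨n - 1, by omega⟩
  let L := (S.mapT E).obj X
  let j := Injective.ι (L.opcycles (m + 1))
  let φ : (S.T.obj E).obj (X.X (m + 1)) ⟶ Injective.under (L.opcycles (m + 1)) :=
    L.pOpcycles (m + 1) ≫ j
  have hφ : (S.T.obj E).map (X.d (m + 1 + 1) (m + 1)) ≫ φ = 0 := by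
    have := L.d_pOpcycles (m + 1 + 1) (m + 1) =≫ j
    rw [Category.assoc, zero_comp] at this
    exact this
  obtain ⟨g, hg⟩ := Cotorsion.exists_d_comp_eq_of_leftPerp hX
    (S.rightPerp_tex_sphere_C hflat₁ E (Injective.under (L.opcycles (m + 1))) m)
    (S.adjC.homEquiv φ) (by
      rw [← S.adjC.homEquiv_naturality_two, hφ,
        ← zero_comp (X := (S.T.obj E).obj (X.X (m + 1 + 1))) (f := φ),
        ← Functor.map_zero (S.T.obj E), S.adjC.homEquiv_naturality_two, zero_comp])
  have h : (S.T.obj E).map (X.d (m + 1) m) ≫ S.adjC.homEquiv.symm g = φ := by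
    rw [← S.adjC.homEquiv_symm_naturality_two, hg, Equiv.symm_apply_apply]
  exact L.exactAt_of_d_comp_eq m j (S.adjC.homEquiv.symm g) h

end BiadditiveTHC

theorem mainTheorem2 {A₁ : Type u₁} {A₂ : Type u₂} {A₃ : Type u₃}
    [Category.{v₁} A₁] [Category.{v₂} A₂] [Category.{v₃} A₃]
    [Abelian A₁] [Abelian A₂] [Abelian A₃]
    [HasLimits A₁] [HasLimits A₂] [HasColimits A₃]
    (S : BiadditiveTHC A₁ A₂ A₃)
    (hflat₁ : Cotorsion.EnoughQuot S.flat₁)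
    (hflat₂ : Cotorsion.EnoughQuot S.flat₂)
    (hinj₃ : EnoughInjectives A₃)
    (hperp : Cotorsion.EnoughSub
      (Cotorsion.underlineRight S.flat₂ (Cotorsion.rightPerp S.flat₂))) :
    Cotorsion.IsCotorsionTheory S.tex (Cotorsion.rightPerp S.tex) := by
  refine ⟨funext fun X => propext ⟨Cotorsion.le_leftPerp_rightPerp _, fun hX => ?_⟩, rfl⟩
  rw [S.tex_iff]
  refine ⟨⟨S.acyclic_of_leftPerp hperp hX, fun n => ?_⟩,
    fun E _ => S.acyclic_mapT_of_leftPerp hflat₁ hinj₃ E hX⟩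
  exact S.flat₂_of_leftPerp hflat₁ hflat₂ hinj₃ (Cotorsion.leftPerp_X_of_disc n
    (fun Y hY => Cotorsion.rightPerp_disc (fun X hX => hX.1.2) hY n) hX)
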